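/- Throughout, rings are commutative with identity and a ring is called quasi-local if it has exactly one maximal ideal (it need not be Noetherian). Let $D$ be an integral domain with quotient field $K$. An overring of $D$ is a subring of $K$ containing $D$; let $\mathcal{O}(D)$ be the set of all overrings of $D$ and $\mathcal{O}_{ql}(D)$ the set of those overrings of $D$ that are quasi-local. An MNI ideal of $D$ is an ideal of $D$ that is maximal among the non-invertible ideals of $D$ (the zero ideal counting as non-invertible). The domain $D$ is an MPD domain if it has a unique MNI ideal $Q$ and every nonzero non-invertible ideal of $D$ is of the form $JQ$ for some invertible ideal $J$ of $D$ (with $J\subseteq D$). The domain $D$ is h-local if each nonzero ideal of $D$ is contained in only finitely many maximal ideals and each nonzero prime ideal of $D$ is contained in a unique maximal ideal. The domain $D$ is a GMPD domain if it is h-local and the localization $D_M$ is an MPD domain for every maximal ideal $M$ of $D$. Lemma. Let $D$ be a quasi-local GMPD domain. Then $\mathcal{O}(D)=\mathcal{O}_{ql}(D)$; that is, every overring of $D$ is quasi-local. -/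

import Mathlib

/-- An (integral) ideal `I` of an integral domain `D` is invertible if it is a unit among the
fractional ideals of `D` in the quotient field of `D`. -/
def IsInvertibleIdeal {D : Type*} [CommRing D] (I : Ideal D) : Prop :=
  IsUnit (I : FractionalIdeal (nonZeroDivisors D) (FractionRing D))

/-- An MNI ideal: an ideal that is maximal, under inclusion, among the non-invertible ideals
(the zero ideal counts as a non-invertible ideal). -/
def IsMNI {D : Type*} [CommRing D] (Q : Ideal D) : Prop :=
  Maximal (fun I : Ideal D => ¬ IsInvertibleIdeal I) Q

/-- A multiplicatively pinched-Dedekind (MPD) domain: an integral domain with a unique MNI ideal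
`Q`, in which every nonzero non-invertible ideal is `J * Q` for some invertible ideal `J`. -/
def IsMPD (D : Type*) [CommRing D] : Prop :=
  IsDomain D ∧
    ∃ Q : Ideal D, (∀ P : Ideal D, IsMNI P ↔ P = Q) ∧
      ∀ I : Ideal D, I ≠ ⊥ → ¬ IsInvertibleIdeal I →
        ∃ J : Ideal D, IsInvertibleIdeal J ∧ I = J * Q

/-- An h-local domain: an integral domain in which each nonzero ideal is contained in only
finitely many maximal ideals and each nonzero prime ideal in a unique maximal ideal. -/
def IsHLocal (D : Type*) [CommRing D] : Prop :=
  IsDomain D ∧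
    (∀ I : Ideal D, I ≠ ⊥ → {M : Ideal D | M.IsMaximal ∧ I ≤ M}.Finite) ∧
    ∀ P : Ideal D, P.IsPrime → P ≠ ⊥ → ∃! M : Ideal D, M.IsMaximal ∧ P ≤ M

/-- A globalized multiplicatively pinched-Dedekind (GMPD) domain: an h-local domain all of whose
localizations at maximal ideals are MPD domains. -/
def IsGMPD (D : Type*) [CommRing D] : Prop :=
  IsHLocal D ∧ ∀ (M : Ideal D) [M.IsMaximal], IsMPD (Localization.AtPrime M)

/-- The set of all overrings of `D` in its quotient field `K`: the subrings of `K` that contain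
(the image of) `D`. -/
def overrings (D K : Type*) [CommRing D] [Field K] [Algebra D K] : Set (Subring K) :=
  {R | (algebraMap D K).range ≤ R}

/-- The set of the quasi-local overrings of `D`, that is, of those with exactly one maximal
ideal (`IsLocalRing` has no Noetherian hypothesis). -/
def quasiLocalOverrings (D K : Type*) [CommRing D] [Field K] [Algebra D K] : Set (Subring K) :=
  {R ∈ overrings D K | IsLocalRing R}

/-! A quasi-local GMPD domain is its own localization at its maximal ideal `M`, and its invertible
ideals are principal, so all its nonzero nonprincipal ideals are multiples `cQ` of one ideal `Q`.
The crux is `PinchedAt.isIntegral_inv_or`: for each `x` in `K`, `x⁻¹` or `(1 - x)⁻¹` is integral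
over `D`. If `x` lies in an overring `R`, the integral inverse lies in `R` too, so `x` or `1 - x` is
a unit of `R`. The crux is easy for a valuation ring. Otherwise `D` is Noetherian and `Q = M`. Then
`(M : M)` is integral over `D`, and it is a valuation ring whose nonunits are exactly the elements
of `M`; hence `y⁻¹` is integral for every nonzero `y` outside `M`, while `1 - y` is a unit of `D`
for `y` in `M`. -/

open IsLocalRing

/-- Every nonzero nonprincipal ideal is a multiple, by an element of the ring, of one fixed
ideal `Q`. -/
def PinchedAt {D : Type*} [CommRing D] (Q : Ideal D) : Prop :=
  ∀ I : Ideal D, I ≠ ⊥ → ¬ I.IsPrincipal → ∃ c : D, I = Ideal.span {c} * Q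

theorem IsInvertibleIdeal.of_mul_right {D : Type*} [CommRing D] {I J : Ideal D}
    (h : IsInvertibleIdeal (I * J)) : IsInvertibleIdeal J := by
  unfold IsInvertibleIdeal at *
  rw [FractionalIdeal.coeIdeal_mul] at h
  exact isUnit_of_mul_isUnit_right h

theorem IsInvertibleIdeal.isPrincipal {D : Type*} [CommRing D] [IsLocalRing D]
    {I : Ideal D} (h : IsInvertibleIdeal I) : I.IsPrincipal := by
  refine Ideal.IsPrincipal.of_finite_maximals_of_isUnit ?_ h
  refine (Set.finite_singleton (maximalIdeal D)).subset fun J hJ => ?_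
  exact eq_maximalIdeal hJ

theorem IsMPD.exists_pinchedAt {D : Type*} [CommRing D] [IsLocalRing D] (h : IsMPD D) :
    ∃ Q : Ideal D, PinchedAt Q := by
  obtain ⟨-, Q, -, hQ⟩ := h
  refine ⟨Q, fun I h0 hI => ?_⟩
  obtain ⟨J, hJ, rfl⟩ := hQ I h0 fun h => hI h.isPrincipal
  obtain ⟨c, rfl⟩ := hJ.isPrincipal
  exact ⟨c, rfl⟩

section Invertible

variable {D : Type*} [CommRing D] [IsDomain D]

theorem IsInvertibleIdeal.of_isPrincipal {I : Ideal D} (h : I.IsPrincipal) (h0 : I ≠ ⊥) :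
    IsInvertibleIdeal I := by
  obtain ⟨c, rfl⟩ := h
  have hc : c ≠ 0 := by rintro rfl; simp at h0
  have hc' : algebraMap D (FractionRing D) c ≠ 0 := by simpa using hc
  unfold IsInvertibleIdeal
  rw [Ideal.submodule_span_eq, FractionalIdeal.coeIdeal_span_singleton]
  refine .of_mul_eq_one
    (FractionalIdeal.spanSingleton _ (algebraMap D (FractionRing D) c)⁻¹) ?_
  rw [FractionalIdeal.spanSingleton_mul_spanSingleton, mul_inv_cancel₀ hc',
    FractionalIdeal.spanSingleton_one]

theorem not_isPrincipal_mul [IsLocalRing D] {I J : Ideal D} (hI : I ≠ ⊥) (hJ : J ≠ ⊥)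
    (h : ¬ J.IsPrincipal) : ¬ (I * J).IsPrincipal := fun hp =>
  h (IsInvertibleIdeal.of_isPrincipal hp (mul_ne_zero hI hJ)).of_mul_right.isPrincipal

end Invertible

theorem PinchedAt.map_ringEquiv_symm {D A : Type*} [CommRing D] [CommRing A] (e : D ≃+* A)
    {Q : Ideal A} (h : PinchedAt Q) : PinchedAt (Q.map e.symm) := by
  have hinv (I : Ideal D) : (I.map e).map e.symm = I := Ideal.map_of_equiv e
  intro I h0 hI
  have hb : I.map e ≠ ⊥ := fun hb => h0 (by rw [← hinv I, hb, Ideal.map_bot])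
  have hp : ¬ (I.map e).IsPrincipal := by
    rintro ⟨c, hc⟩
    exact hI ⟨e.symm c, by
      rw [← hinv I, hc, Ideal.submodule_span_eq, Ideal.map_span, Set.image_singleton]⟩
  obtain ⟨c, hc⟩ := h _ hb hp
  exact ⟨e.symm c, by rw [← hinv I, hc, Ideal.map_mul, Ideal.map_span, Set.image_singleton]⟩

theorem IsGMPD.exists_pinchedAt {D : Type*} [CommRing D] [IsLocalRing D] (h : IsGMPD D) :
    ∃ Q : Ideal D, PinchedAt Q := by
  let e : D ≃ₐ[D] Localization.AtPrime (maximalIdeal D) :=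
    IsLocalization.atUnits D (maximalIdeal D).primeCompl fun x hx => by
      rw [IsUnit.mem_submonoid_iff]
      simpa [Ideal.primeCompl] using hx
  obtain ⟨Q, hQ⟩ := (h.2 (maximalIdeal D)).exists_pinchedAt
  exact ⟨_, hQ.map_ringEquiv_symm e.toRingEquiv⟩

theorem PinchedAt.eq_maximalIdeal {D : Type*} [CommRing D] [IsLocalRing D] {Q : Ideal D}
    (h : PinchedAt Q) (hM : ¬ (maximalIdeal D).IsPrincipal) : Q = maximalIdeal D := by
  have h0 : maximalIdeal D ≠ ⊥ := fun hb => hM (hb ▸ inferInstance)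
  obtain ⟨c, hc⟩ := h _ h0 hM
  refine le_antisymm (le_maximalIdeal ?_) (hc.le.trans Ideal.mul_le_right)
  rintro rfl
  exact hM ⟨c, by rw [hc]; simp⟩

section Local

variable {D : Type*} [CommRing D] [IsDomain D] [IsLocalRing D]

/-- A local Bezout domain is a valuation ring, so some finitely generated ideal is nonprincipal. It
equals `cQ`, which is isomorphic to `Q`; thus `Q`, and with it every ideal, is finitely generated.
-/
theorem PinchedAt.isNoetherianRing {Q : Ideal D} (h : PinchedAt Q) (hv : ¬ ValuationRing D) :
    IsNoetherianRing D := by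
  have hQ : Q.FG := by
    have hb : ¬ IsBezout D := fun hb => hv (ValuationRing.iff_local_bezout_domain.2 ⟨‹_›, hb⟩)
    have : ∃ I : Ideal D, I.FG ∧ ¬ I.IsPrincipal := by
      by_contra! hcon
      exact hb ⟨fun I hI => hcon I hI⟩
    obtain ⟨I, hfg, hI⟩ := this
    have h0 : I ≠ ⊥ := by rintro rfl; exact hI inferInstance
    obtain ⟨c, rfl⟩ := h I h0 hI
    have hc : c ≠ 0 := by rintro rfl; simp at h0
    refine Submodule.fg_of_fg_map_injective (LinearMap.mulLeft D c)
      (mul_right_injective₀ hc) ?_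
    convert! hfg using 1
    ext x
    simp [Ideal.mem_span_singleton_mul]
  rw [isNoetherianRing_iff_ideal_fg]
  intro I
  by_cases hI : I.IsPrincipal
  · exact Submodule.IsPrincipal.fg hI
  · have h0 : I ≠ ⊥ := by rintro rfl; exact hI inferInstance
    obtain ⟨c, rfl⟩ := h I h0 hI
    exact Submodule.FG.mul ⟨{c}, by simp⟩ hQ

theorem not_isPrincipal_maximalIdeal [IsNoetherianRing D] (hv : ¬ ValuationRing D) :
    ¬ (maximalIdeal D).IsPrincipal := fun h =>
  hv (((tfae_of_isNoetherianRing_of_isLocalRing_of_isDomain D).out 4 1).1 h)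

end Local

/-! ### The ring of multipliers `(M : M)`. -/

section Multiplier

variable {D K : Type*} [CommRing D] [Field K] [Algebra D K]

/-- Multiplication by `y` maps the ideal `M` of `D` into itself. -/
def Stabilizes (M : Ideal D) (y : K) : Prop :=
  ∀ n ∈ M, ∃ n' ∈ M, y * algebraMap D K n = algebraMap D K n'

theorem Stabilizes.mul {M : Ideal D} {y z : K} (hy : Stabilizes M y) (hz : Stabilizes M z) :
    Stabilizes M (y * z) := by
  intro n hn
  obtain ⟨n₁, h₁, e₁⟩ := hz n hn
  obtain ⟨n₂, h₂, e₂⟩ := hy n₁ h₁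
  exact ⟨n₂, h₂, by rw [mul_assoc, e₁, e₂]⟩

variable [IsFractionRing D K]

theorem Stabilizes.isIntegral {M : Ideal D} (hM : M ≠ ⊥) (hfg : M.FG) {y : K}
    (hy : Stabilizes M y) : IsIntegral D y := by
  have hinj : Function.Injective (Algebra.linearMap D K) := IsFractionRing.injective D K
  refine isIntegral_of_smul_mem_submodule (M := K) (Submodule.map (Algebra.linearMap D K) M) ?_
    (Submodule.FG.map _ hfg) y ?_
  · rwa [Ne, ← Submodule.map_bot (Algebra.linearMap D K),
      (Submodule.map_injective_of_injective hinj).eq_iff]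
  · rintro _ ⟨n, hn, rfl⟩
    obtain ⟨n', hn', e⟩ := hy n hn
    exact ⟨n', hn', e.symm⟩

variable [IsDomain D] [IsLocalRing D]

/-- If `M ^ 2 = a M`, every nonzero element of `(M : M)` is in `M` or is a unit of `(M : M)`. -/
theorem Stabilizes.mem_or_inv {y : K} (hy0 : y ≠ 0) (hy : Stabilizes (maximalIdeal D) y)
    (hpin : PinchedAt (maximalIdeal D)) (hM : ¬ (maximalIdeal D).IsPrincipal)
    {a : D} (ha : a ∈ maximalIdeal D) (ha0 : a ≠ 0)
    (hsq : maximalIdeal D * maximalIdeal D = Ideal.span {a} * maximalIdeal D) :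
    (∃ m ∈ maximalIdeal D, y = algebraMap D K m) ∨ Stabilizes (maximalIdeal D) y⁻¹ := by
  have hinj : Function.Injective (algebraMap D K) := IsFractionRing.injective D K
  have hM0 : maximalIdeal D ≠ ⊥ := fun hb => hM (hb ▸ inferInstance)
  obtain ⟨p, q, hq, e⟩ := IsFractionRing.div_surjective (A := D) y
  have hq0 : q ≠ 0 := nonZeroDivisors.ne_zero hq
  have hq' : algebraMap D K q ≠ 0 := by simpa using hq0
  have hp0 : p ≠ 0 := by rintro rfl; simp at e; exact hy0 e.symm
  have epq : algebraMap D K p = y * algebraMap D K q := by rw [← e]; field_simp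
  -- `I` is `yM`, seen as an ideal of `D`. With `y = p/q`, it is nonprincipal because `qI = pM` is.
  let I : Ideal D := Submodule.comap (Algebra.linearMap D K)
    (Submodule.map (LinearMap.mulLeft D y ∘ₗ Algebra.linearMap D K) (maximalIdeal D))
  have hI (n' : D) : n' ∈ I ↔ ∃ n ∈ maximalIdeal D, y * algebraMap D K n = algebraMap D K n' := by
    rfl
  have hqI : Ideal.span {q} * I = Ideal.span {p} * maximalIdeal D := by
    ext z
    rw [Ideal.mem_span_singleton_mul, Ideal.mem_span_singleton_mul]
    constructor
    · rintro ⟨n', h', rfl⟩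
      obtain ⟨n, hn, en⟩ := (hI _).1 h'
      refine ⟨n, hn, hinj ?_⟩
      rw [map_mul, map_mul, ← en, epq]; ring
    · rintro ⟨n, hn, rfl⟩
      obtain ⟨n', hn', en⟩ := hy n hn
      refine ⟨n', (hI _).2 ⟨n, hn, en⟩, hinj ?_⟩
      rw [map_mul, map_mul, ← en, epq]; ring
  have hspan {d : D} (hd : d ≠ 0) : Ideal.span {d} ≠ ⊥ := by simpa using hd
  have hI0 : I ≠ ⊥ := by
    intro hb
    rw [hb, Ideal.mul_bot] at hqI
    exact mul_ne_zero (hspan hp0) hM0 hqI.symm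
  have hIp : ¬ I.IsPrincipal := by
    intro hp
    refine not_isPrincipal_mul (hspan hp0) hM0 hM ?_
    rw [← hqI]
    obtain ⟨d, hd⟩ := hp
    exact ⟨q * d, by rw [hd, Ideal.submodule_span_eq, Ideal.span_singleton_mul_span_singleton]⟩
  obtain ⟨c, hc⟩ := hpin I hI0 hIp
  -- Here `yM = cM`. If `c ∈ M`, then `ya ∈ M² = aM`, and cancelling `a` puts `y` in `M`; if `c` is
  -- a unit, then `yM = M`.
  by_cases hcM : c ∈ maximalIdeal D
  · left
    obtain ⟨n', -, en⟩ := hy a ha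
    have : n' ∈ Ideal.span {a} * maximalIdeal D := by
      rw [← hsq]
      exact Ideal.mul_mono_left ((Ideal.span_singleton_le_iff_mem _).2 hcM)
        (hc ▸ (hI n').2 ⟨a, ha, en⟩)
    obtain ⟨m, hm, rfl⟩ := Ideal.mem_span_singleton_mul.1 this
    refine ⟨m, hm, ?_⟩
    have ha' : algebraMap D K a ≠ 0 := by simpa using ha0
    apply mul_right_cancel₀ ha'
    rw [en, map_mul, mul_comm]
  · right
    have hu : IsUnit c := by simpa using hcM
    rw [Ideal.span_singleton_eq_top.2 hu, Ideal.top_mul] at hc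
    intro n hn
    obtain ⟨n', hn', en⟩ := (hI n).1 (hc ▸ hn)
    exact ⟨n', hn', by rw [← en, inv_mul_cancel_left₀ hy0]⟩

theorem PinchedAt.exists_sq_eq [IsNoetherianRing D] (hpin : PinchedAt (maximalIdeal D))
    (hM : ¬ (maximalIdeal D).IsPrincipal) :
    ∃ a ∈ maximalIdeal D, a ≠ 0 ∧
      maximalIdeal D * maximalIdeal D = Ideal.span {a} * maximalIdeal D := by
  have hM0 : maximalIdeal D ≠ ⊥ := fun hb => hM (hb ▸ inferInstance)
  have hne : maximalIdeal D * maximalIdeal D ≠ ⊥ := mul_ne_zero hM0 hM0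
  obtain ⟨a, ha⟩ := hpin _ hne (not_isPrincipal_mul hM0 hM0 hM)
  refine ⟨a, ?_, ?_, ha⟩
  · by_contra hcon
    have hu : IsUnit a := by simpa using hcon
    rw [Ideal.span_singleton_eq_top.2 hu, Ideal.top_mul] at ha
    exact hM0 (Submodule.eq_bot_of_le_smul_of_le_jacobson_bot _ _ (IsNoetherian.noetherian _)
      ha.ge (maximalIdeal_le_jacobson _))
  · rintro rfl
    exact hne (by rw [ha]; simp)

/-- Write `x = p/q`, `N = (p, q)` and `NM = cM`. Both `p/c` and `q/c` lie in `(M : M)`, and one of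
them is a unit there, so `x` or `x⁻¹` lies in `(M : M)`. -/
theorem stabilizes_or_inv_mem [IsNoetherianRing D] (hpin : PinchedAt (maximalIdeal D))
    (hM : ¬ (maximalIdeal D).IsPrincipal) {x : K} (hx : x ≠ 0) :
    Stabilizes (maximalIdeal D) x ∨ ∃ m ∈ maximalIdeal D, x⁻¹ = algebraMap D K m := by
  have hM0 : maximalIdeal D ≠ ⊥ := fun hb => hM (hb ▸ inferInstance)
  obtain ⟨a, ha, ha0, hsq⟩ := hpin.exists_sq_eq hM
  have hinj : Function.Injective (algebraMap D K) := IsFractionRing.injective D K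
  obtain ⟨p, q, hq, e⟩ := IsFractionRing.div_surjective (A := D) x
  have hq0 : q ≠ 0 := nonZeroDivisors.ne_zero hq
  have hp0 : p ≠ 0 := by rintro rfl; simp at e; exact hx e.symm
  have hN0 : Ideal.span {p, q} ≠ ⊥ := by
    intro hb
    exact hp0 (by simpa [hb] using (Ideal.subset_span (by simp) : p ∈ Ideal.span {p, q}))
  obtain ⟨c, hc⟩ := hpin _ (mul_ne_zero hN0 hM0) (not_isPrincipal_mul hN0 hM0 hM)
  have hc0 : c ≠ 0 := by
    rintro rfl
    exact mul_ne_zero hN0 hM0 (hc.trans (by simp))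
  have hp' : algebraMap D K p ≠ 0 := by simpa using hp0
  have hq' : algebraMap D K q ≠ 0 := by simpa using hq0
  have hc' : algebraMap D K c ≠ 0 := by simpa using hc0
  have hstab {r : D} (hr : r ∈ Ideal.span {p, q}) :
      Stabilizes (maximalIdeal D) (algebraMap D K r / algebraMap D K c) := by
    intro n hn
    obtain ⟨z, hz, ez⟩ := Ideal.mem_span_singleton_mul.1 (hc ▸ Ideal.mul_mem_mul hr hn)
    refine ⟨z, hz, ?_⟩
    rw [div_mul_eq_mul_div, div_eq_iff hc', ← map_mul, ← map_mul, ← ez, mul_comm]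
  have hsp := hstab (Ideal.subset_span (by simp) : p ∈ Ideal.span {p, q})
  have hsq' := hstab (Ideal.subset_span (by simp) : q ∈ Ideal.span {p, q})
  have qunit := hsq'.mem_or_inv (div_ne_zero hq' hc') hpin hM ha ha0 hsq
  have punit := hsp.mem_or_inv (div_ne_zero hp' hc') hpin hM ha ha0 hsq
  rcases qunit with ⟨m₂, hm₂, e₂⟩ | hs
  · rcases punit with ⟨m₁, hm₁, e₁⟩ | hs
    -- If both were in `M`, then `N ⊆ cM`, so `cM = NM ⊆ cM²` and `M ⊆ M²`, against Nakayama.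
    · exfalso
      rw [div_eq_iff hc', ← map_mul] at e₁ e₂
      have hle : Ideal.span {p, q} ≤ Ideal.span {c} * maximalIdeal D := by
        rw [Ideal.span_le]
        rintro r (rfl | rfl)
        · exact Ideal.mem_span_singleton_mul.2 ⟨m₁, hm₁, by rw [hinj e₁, mul_comm]⟩
        · exact Ideal.mem_span_singleton_mul.2 ⟨m₂, hm₂, by rw [hinj e₂, mul_comm]⟩
      have hle' := hc.ge.trans (Ideal.mul_mono_left hle (K := maximalIdeal D))
      rw [mul_assoc, Ideal.span_singleton_mul_right_mono hc0] at hle'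
      exact hM0 (Submodule.eq_bot_of_le_smul_of_le_jacobson_bot _ _ (IsNoetherian.noetherian _)
        hle' (maximalIdeal_le_jacobson _))
    · have hinv : Stabilizes (maximalIdeal D) x⁻¹ := by
        convert! hsq'.mul hs using 1
        rw [← e]; field_simp
      have := hinv.mem_or_inv (inv_ne_zero hx) hpin hM ha ha0 hsq
      rw [inv_inv] at this
      exact this.symm
  · left
    convert! hsp.mul hs using 1
    rw [← e]; field_simp

theorem PinchedAt.isIntegral_inv_or {Q : Ideal D} (h : PinchedAt Q) (x : K) :
    IsIntegral D x⁻¹ ∨ IsIntegral D (1 - x)⁻¹ := by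
  have hunit {d : D} (hd : IsUnit d) : IsIntegral D (algebraMap D K d)⁻¹ := by
    obtain ⟨u, rfl⟩ := hd
    rw [← map_units_inv]
    exact isIntegral_algebraMap
  by_cases hv : ValuationRing D
  · rcases ValuationRing.isInteger_or_isInteger D x with ⟨d, rfl⟩ | ⟨d, hd⟩
    · refine (isUnit_or_isUnit_one_sub_self d).imp hunit fun hd => ?_
      simpa using hunit (d := 1 - d) hd
    · exact .inl (hd ▸ isIntegral_algebraMap)
  have := h.isNoetherianRing hv
  have hM := not_isPrincipal_maximalIdeal hv
  have hM0 : maximalIdeal D ≠ ⊥ := fun hb => hM (hb ▸ inferInstance)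
  rw [h.eq_maximalIdeal hM] at h
  rcases eq_or_ne x 0 with rfl | hx
  · left; simpa using isIntegral_zero
  rcases eq_or_ne (1 - x) 0 with hx1 | hx1
  · right; simpa [hx1] using isIntegral_zero
  obtain ⟨a, ha, ha0, hsq⟩ := h.exists_sq_eq hM
  have key {y : K} (hy : y ≠ 0) :
      IsIntegral D y⁻¹ ∨ ∃ m ∈ maximalIdeal D, y = algebraMap D K m := by
    rcases stabilizes_or_inv_mem h hM hy with hs | ⟨m, -, hm⟩
    · exact ((hs.mem_or_inv hy h hM ha ha0 hsq).imp_right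
        fun hs' => hs'.isIntegral hM0 (IsNoetherian.noetherian _)).symm
    · exact .inl (hm ▸ isIntegral_algebraMap)
  rcases key hx with hi | ⟨m, hm, rfl⟩
  · exact .inl hi
  · right
    have : IsUnit (1 - m) := (isUnit_or_isUnit_one_sub_self m).resolve_left hm
    simpa using hunit this

end Multiplier

/-- If the inverse of an element `x` of a field is integral over a subring containing `x`, it
belongs to that subring. -/
theorem Subring.inv_mem_of_isIntegral {K : Type*} [Field K] (R : Subring K) {x : K} (hx : x ∈ R)
    (h : IsIntegral R x⁻¹) : x⁻¹ ∈ R := by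
  rcases eq_or_ne x 0 with rfl | hx0
  · simp
  obtain ⟨p, hp, he⟩ := h
  have hpos : 0 < p.natDegree := by
    refine Nat.pos_of_ne_zero fun hd => ?_
    rw [hp.natDegree_eq_zero.1 hd] at he
    simp at he
  rw [Polynomial.eval₂_eq_sum_range, Finset.sum_range_succ, hp.coeff_natDegree, map_one,
    one_mul] at he
  -- The integral equation rewrites `x⁻ⁿ` through lower powers of `x⁻¹`; the factor `xⁿ⁻¹` clears
  -- them all.
  have hx' : x⁻¹ = x⁻¹ ^ p.natDegree * x ^ (p.natDegree - 1) := by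
    obtain ⟨k, hk⟩ := Nat.exists_eq_succ_of_ne_zero hpos.ne'
    rw [hk, Nat.succ_sub_one, pow_succ', mul_assoc, ← mul_pow, inv_mul_cancel₀ hx0, one_pow,
      mul_one]
  rw [hx', eq_neg_of_add_eq_zero_right he, neg_mul, Finset.sum_mul]
  refine R.neg_mem (R.sum_mem fun i hi => ?_)
  have hi' : i ≤ p.natDegree - 1 := by
    have := Finset.mem_range.1 hi
    omega
  obtain ⟨j, hj⟩ := Nat.exists_eq_add_of_le hi'
  rw [hj, pow_add, mul_assoc, ← mul_assoc (x⁻¹ ^ i), ← mul_pow, inv_mul_cancel₀ hx0, one_pow,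
    one_mul]
  exact R.mul_mem (p.coeff i).2 (R.pow_mem hx j)

theorem Subring.isUnit_of_inv_mem {K : Type*} [Field K] (R : Subring K) {x : R}
    (h0 : (x : K) ≠ 0) (h : (x : K)⁻¹ ∈ R) : IsUnit x :=
  .of_mul_eq_one ⟨_, h⟩ (Subtype.ext (mul_inv_cancel₀ h0))

theorem lemma2p3 (D K : Type*) [CommRing D] [IsDomain D] [Field K] [Algebra D K]
    [IsFractionRing D K] [IsLocalRing D] (hD : IsGMPD D) :
    overrings D K = quasiLocalOverrings D K := by
  refine Set.Subset.antisymm (fun R hR => ⟨hR, ?_⟩) fun R hR => hR.1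
  obtain ⟨Q, hQ⟩ := hD.exists_pinchedAt
  have hint {y : K} (hy : IsIntegral D y) : IsIntegral R y := by
    obtain ⟨p, hp, he⟩ := hy
    let f : D →+* R := (algebraMap D K).codRestrict R fun d => hR ⟨d, rfl⟩
    refine ⟨p.map f, hp.map f, ?_⟩
    rw [Polynomial.eval₂_map]
    exact he
  refine IsLocalRing.of_isUnit_or_isUnit_one_sub_self fun x => ?_
  rcases eq_or_ne x 0 with rfl | hx0
  · right; simp
  rcases eq_or_ne (1 - x) 0 with hx1 | hx1
  · left
    rw [← sub_eq_zero.1 hx1]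
    exact isUnit_one
  refine (hQ.isIntegral_inv_or (x : K)).imp (fun h => ?_) fun h => ?_
  · exact R.isUnit_of_inv_mem (by simpa using hx0) (R.inv_mem_of_isIntegral x.2 (hint h))
  · exact R.isUnit_of_inv_mem (x := 1 - x) (fun hz => hx1 (Subtype.ext hz))
      (R.inv_mem_of_isIntegral (1 - x).2 (hint h))
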